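/- Let $m\ge 2$ and let $\varphi_m$ be the morphism on words over the alphabet $\{0,1,\dots,m-1\}$ given by $0\mapsto 01,\ 1\mapsto 02,\ \dots,\ (m-2)\mapsto 0(m-1),\ (m-1)\mapsto 0$. Put $h_n=\varphi_m^n(0)$ for $n\ge 0$, and let the infinite $m$-bonacci word $h_\omega=\lim_{n\to\infty} h_n$ be the fixed point of $\varphi_m$ that starts with $0$. Write $w^R$ for the reverse of a word $w$, $\underline{n}$ for the letter $n \bmod m$, and $a^{-1}w=v$ if $w=av$. Define words $z_n$ $(n\ge 0)$ by $z_0=0$, $z_1=1$, $z_2=00$ if $m=2$ and $z_2=020$ if $m\ge 3$, and for $n\ge 3$ $$z_n=\begin{cases}(n-3)^{-1}\,h_{n-3}^R\,h_{n-2}^R\; n\; h_0^R\,h_1^R\cdots h_{n-3}^R\;(n-2), & 3\le n\le m-1,\\ (\underline{n-3})^{-1}\,h_{n-3}^R\,h_{n-2}^R\;h_{n-m}^R\,h_{n-m+1}^R\cdots h_{n-3}^R\;\underline{n-2}, & n\ge m,\end{cases}$$ where for $m=2$ the product $h_{n-m}^R\cdots h_{n-3}^R$ is empty. A finite word is closed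 if it is a single letter or has a non-empty prefix that is also a suffix of it and that occurs in it exactly twice. The closed $z$-factorization of an infinite word $\boldsymbol w$ is the sequence $(y_0,y_1,y_2,\dots)$ of finite words with $\boldsymbol w=y_0y_1y_2\cdots$ such that, for every $n\ge 0$, $y_n$ is the shortest closed prefix $x$ of the infinite word $y_ny_{n+1}y_{n+2}\cdots$ that occurs exactly once in $y_0y_1\cdots y_{n-1}x$. Theorem. For every $m\ge 2$, the closed $z$-factorization of $h_\omega$ is $(z_0,z_1,z_2,\dots)$. -/

import Mathlib

/-! ### Finite and infinite words, occurrences, closed words -/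

section Words

variable {α : Type*}

/-- `|w|_x`: the number of occurrences of `x` in `w`, i.e. of the positions `i` at which `x` can be
read in `w`. -/
def occurrences [DecidableEq α] (x w : List α) : ℕ :=
  ((Finset.range (w.length + 1)).filter (fun i => x <+: w.drop i)).card

/-- A border of `w` is a non-empty word that is both a prefix and a suffix of `w`. -/
def IsBorder (x w : List α) : Prop :=
  x ≠ [] ∧ x <+: w ∧ x <:+ w

/-- A word is closed if it is a single letter or has a border with exactly two occurrences. -/
def IsClosedWord [DecidableEq α] (w : List α) : Prop :=
  w.length = 1 ∨ ∃ x, IsBorder x w ∧ occurrences x w = 2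

/-- The finite word `x` occurs in the infinite word `w` at position `k`, i.e. `x` is a prefix of
`w k, w (k + 1), w (k + 2), …`. -/
def OccursAt (x : List α) (w : ℕ → α) (k : ℕ) : Prop :=
  ∀ i (hi : i < x.length), x[i] = w (k + i)

/-- The product `z 0 ⋯ z (n - 1)` of the first `n` words of a sequence of words. -/
def productUpTo (z : ℕ → List α) (n : ℕ) : List α :=
  (List.range n).flatMap z

/-- `x` is closed and occurs exactly once in `p x`, where `p` is the part of the word already
factorized. -/
def IsNewClosed [DecidableEq α] (p x : List α) : Prop :=
  IsClosedWord x ∧ occurrences x (p ++ x) = 1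

/-- `(z 0, z 1, z 2, …)` is the closed `z`-factorization of the infinite word `w`: the product of
the `z n` is `w`, and each `z n` is the shortest closed prefix `x` of the remaining infinite word
`z n, z (n + 1), …` that occurs exactly once in `z 0 ⋯ z (n - 1) x`. -/
structure IsClosedZFactorization [DecidableEq α] (w : ℕ → α) (z : ℕ → List α) : Prop where
  product_prefix : ∀ n, OccursAt (productUpTo z n) w 0
  occursAt : ∀ n, OccursAt (z n) w (productUpTo z n).length
  isNewClosed : ∀ n, IsNewClosed (productUpTo z n) (z n)
  shortest : ∀ n x, OccursAt x w (productUpTo z n).length →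
    IsNewClosed (productUpTo z n) x → (z n).length ≤ x.length

/-- An infinite word has at most one closed `z`-factorization. -/
theorem IsClosedZFactorization.unique [DecidableEq α] {w : ℕ → α} {z z' : ℕ → List α}
    (h : IsClosedZFactorization w z) (h' : IsClosedZFactorization w z') : z = z' := by
  funext n
  induction n using Nat.strong_induction_on with
  | _ n ih =>
    have hp : productUpTo z n = productUpTo z' n := by
      simp only [productUpTo, List.flatMap]
      congr 1
      exact List.map_congr_left fun i hi => ih i (List.mem_range.1 hi)
    have hl : (z n).length = (z' n).length :=
      le_antisymm (h.shortest n _ (hp ▸ h'.occursAt n) (hp ▸ h'.isNewClosed n))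
        (h'.shortest n _ (hp ▸ h.occursAt n) (hp ▸ h.isNewClosed n))
    refine List.ext_getElem hl fun i h1 h2 => ?_
    rw [h.occursAt n i h1, h'.occursAt n i h2, hp]

/-- `u⁻¹ w`: the word `v` with `w = u v` (used only when `u` is a prefix of `w`). -/
def leftCancel (u w : List α) : List α :=
  w.drop u.length

end Words

/-! ### The `m`-bonacci words over the alphabet `{0, …, m - 1}` -/

section MBonacci

variable (m : ℕ) [NeZero m]

/-- The letter `n mod m`. -/
def letter (n : ℕ) : Fin m := Fin.ofNat m n

/-- The morphism `0 ↦ 01, …, m - 2 ↦ 0 (m - 1), m - 1 ↦ 0` on letters. -/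
def mbonacciLetter (a : Fin m) : List (Fin m) :=
  if a.val + 1 < m then [0, letter m (a.val + 1)] else [0]

/-- The same morphism on finite words. -/
def mbonacciMorphism (w : List (Fin m)) : List (Fin m) :=
  w.flatMap (mbonacciLetter m)

/-- The finite `m`-bonacci word `h n`, the `n`-th iterate of the morphism on the letter `0`. -/
def finiteMBonacci (n : ℕ) : List (Fin m) :=
  (mbonacciMorphism m)^[n] [0]

/-- The infinite `m`-bonacci word, the limit of the finite ones: its letter in position `k` is that
of `h k`, which for `m ≥ 2` has more than `k` letters and is a prefix of all later `h n`. -/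
def infiniteMBonacci (k : ℕ) : Fin m :=
  (finiteMBonacci m k).getD k 0

/-- The word `(h i)ᴿ`. -/
def revMBonacci (i : ℕ) : List (Fin m) :=
  (finiteMBonacci m i).reverse

/-- The words `z n`: here `z 2` is `00` for `m = 2` and `020` for `m ≥ 3`. In the last case the
product `(h (n - m))ᴿ ⋯ (h (n - 3))ᴿ` has `m - 2` factors, so that it is empty for `m = 2`. -/
def closedFactor : ℕ → List (Fin m)
  | 0 => [0]
  | 1 => [letter m 1]
  | 2 => if m = 2 then [0, 0] else [0, letter m 2, 0]
  | n@(_ + 3) =>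
    if n < m then
      leftCancel [letter m (n - 3)] (revMBonacci m (n - 3)) ++ revMBonacci m (n - 2) ++
        [letter m n] ++ (List.range (n - 2)).flatMap (revMBonacci m) ++ [letter m (n - 2)]
    else
      leftCancel [letter m (n - 3)] (revMBonacci m (n - 3)) ++ revMBonacci m (n - 2) ++
        (List.range' (n - m) (m - 2)).flatMap (revMBonacci m) ++ [letter m (n - 2)]

theorem finiteMBonacci_succ (n : ℕ) :
    finiteMBonacci m (n + 1) = mbonacciMorphism m (finiteMBonacci m n) :=
  Function.iterate_succ_apply' _ _ _

/-- `(h n)ᴿ` starts with the letter `n mod m`, so that the cancellation in `closedFactor` is a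
genuine one. -/
theorem letter_prefix_revMBonacci (n : ℕ) : [letter m n] <+: revMBonacci m n := by
  have key : ∃ t, finiteMBonacci m n = t ++ [letter m n] := by
    induction n with
    | zero => exact ⟨[], rfl⟩
    | succ n ih =>
      obtain ⟨t, ht⟩ := ih
      have hpos : 0 < m := Nat.pos_of_ne_zero (NeZero.ne m)
      rw [finiteMBonacci_succ, ht, mbonacciMorphism, List.flatMap_append]
      by_cases hlt : (letter m n).val + 1 < m
      · refine ⟨t.flatMap (mbonacciLetter m) ++ [0], ?_⟩
        have : letter m ((letter m n).val + 1) = letter m (n + 1) := by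
          apply Fin.ext; simp [letter, Fin.ofNat]
        simp [mbonacciLetter, hlt, this]
      · refine ⟨t.flatMap (mbonacciLetter m), ?_⟩
        have : (0 : Fin m) = letter m (n + 1) := by
          have h1 : n % m < m := Nat.mod_lt _ hpos
          have h2 : n % m + 1 = m := by
            simp only [letter, Fin.ofNat] at hlt
            omega
          apply Fin.ext
          simp only [letter, Fin.ofNat, Fin.val_zero]
          rw [← Nat.mod_add_mod, h2, Nat.mod_self]
        simp [mbonacciLetter, hlt, this]
  obtain ⟨t, ht⟩ := key
  simp [revMBonacci, ht]

theorem mbonacciLetter_zero (hm : 2 ≤ m) : mbonacciLetter m 0 = [0, letter m 1] := by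
  have : (0 : Fin m).val + 1 < m := by simp; omega
  simp [mbonacciLetter, show 1 < m by omega]

theorem mbonacciMorphism_mono {u v : List (Fin m)} (h : u <+: v) :
    mbonacciMorphism m u <+: mbonacciMorphism m v := by
  obtain ⟨t, rfl⟩ := h
  simp [mbonacciMorphism]

theorem length_le_mbonacciMorphism (u : List (Fin m)) :
    u.length ≤ (mbonacciMorphism m u).length := by
  induction u with
  | nil => simp
  | cons a u ih =>
    have h1 : 1 ≤ (mbonacciLetter m a).length := by
      unfold mbonacciLetter; split <;> simp
    simp only [mbonacciMorphism, List.flatMap_cons, List.length_append, List.length_cons] at ih ⊢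
    omega

theorem finiteMBonacci_prefix_succ (hm : 2 ≤ m) (n : ℕ) :
    finiteMBonacci m n <+: finiteMBonacci m (n + 1) := by
  induction n with
  | zero =>
    rw [finiteMBonacci_succ]
    simp [finiteMBonacci, mbonacciMorphism, mbonacciLetter_zero m hm]
  | succ n ih =>
    rw [finiteMBonacci_succ m n, finiteMBonacci_succ m (n + 1)]
    exact mbonacciMorphism_mono m ih

theorem finiteMBonacci_prefix (hm : 2 ≤ m) {i j : ℕ} (h : i ≤ j) :
    finiteMBonacci m i <+: finiteMBonacci m j := by
  induction h with
  | refl => exact List.prefix_rfl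
  | step _ ih => exact ih.trans (finiteMBonacci_prefix_succ m hm _)

theorem lt_length_finiteMBonacci (hm : 2 ≤ m) (n : ℕ) : n < (finiteMBonacci m n).length := by
  induction n with
  | zero => simp [finiteMBonacci]
  | succ n ih =>
    obtain ⟨t, ht⟩ : [0] <+: finiteMBonacci m n := finiteMBonacci_prefix m hm (Nat.zero_le n)
    have h := length_le_mbonacciMorphism m t
    rw [finiteMBonacci_succ]
    rw [← ht] at ih ⊢
    simp only [mbonacciMorphism, List.flatMap_append, List.flatMap_cons, List.flatMap_nil,
      mbonacciLetter_zero m hm, List.length_append, List.length_cons, List.length_nil] at ih h ⊢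
    omega

/-- Every finite `m`-bonacci word is a prefix of the infinite one. -/
theorem finiteMBonacci_occursAt (hm : 2 ≤ m) (n : ℕ) :
    OccursAt (finiteMBonacci m n) (infiniteMBonacci m) 0 := by
  intro i hi
  have hi' := lt_length_finiteMBonacci m hm i
  simp only [Nat.zero_add, infiniteMBonacci, List.getD_eq_getElem _ _ hi']
  rcases le_total n i with h | h
  · exact (finiteMBonacci_prefix m hm h).getElem hi
  · exact ((finiteMBonacci_prefix m hm h).getElem hi').symm

/-- The infinite `m`-bonacci word is the unique fixed point of the morphism that starts with `0`:
the morphism maps every prefix of it to a prefix of it. -/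
theorem eq_infiniteMBonacci_iff (hm : 2 ≤ m) (w : ℕ → Fin m) :
    w = infiniteMBonacci m ↔ w 0 = 0 ∧
      ∀ u, OccursAt u w 0 → OccursAt (mbonacciMorphism m u) w 0 := by
  constructor
  · rintro rfl
    refine ⟨by simp [infiniteMBonacci, finiteMBonacci], fun u hu => ?_⟩
    have hpre : u <+: finiteMBonacci m u.length := by
      have hlen := lt_length_finiteMBonacci m hm u.length
      refine List.prefix_iff_eq_take.2 (List.ext_getElem (by simp; omega) fun i h1 h2 => ?_)
      rw [hu i h1, List.getElem_take, finiteMBonacci_occursAt m hm u.length]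
    have hp := mbonacciMorphism_mono m hpre
    rw [← finiteMBonacci_succ] at hp
    intro i hi
    rw [hp.getElem hi, finiteMBonacci_occursAt m hm]
  · rintro ⟨h0, hfix⟩
    have hn : ∀ n, OccursAt (finiteMBonacci m n) w 0 := by
      intro n
      induction n with
      | zero =>
        intro i hi
        have : i = 0 := by simpa [finiteMBonacci] using hi
        subst this
        simpa [finiteMBonacci] using h0.symm
      | succ n ih => rw [finiteMBonacci_succ]; exact hfix _ ih
    funext k
    have hk := lt_length_finiteMBonacci m hm k
    have h1 := hn k k hk
    have h2 := finiteMBonacci_occursAt m hm k k hk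
    simp only [Nat.zero_add] at h1 h2
    rw [← h1, h2]

end MBonacci

/-!
Write `𝐰` for the infinite word and `φ` for the morphism. A position-by-position description of `𝐰`
replaces all computations with words: if `cut i` is the length of the image of the prefix of length
`i`, then `𝐰 (cut i) = 0` and `𝐰 (cut i + 1) = 𝐰 i + 1` in `Fin m`, and every position has one of
these two forms. Iterating, `𝐰` is the product of the images of its letters under `φ ^ k`, which
start at the positions `cut^[k] i`.

The palindromic prefixes `u 0 = ε`, `u (k + 1) = φ (u k) 0` of `𝐰` occur exactly at the positions
`cut^[k] i`; there `u k` is followed by the letter `𝐰 i + k` and preceded by `𝐰 (i - 1) + k`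
(`exists_eq_iterate_cut`, `infiniteMBonacci_iterate_cut_add_palLength`,
`infiniteMBonacci_iterate_cut_succ_sub_one`). Moreover `u (k + 1) = u k (h k)ᴿ`, so that the words
`(h k)ᴿ` are factors of `𝐰` at known positions. Hence so is the `(k + 2)`-nd factor
(`closedFactor_eq_seg`): it ends right after the occurrence of `u k` at `cut^[k] (cut 2)` and the
letter following it, and the word `B` of the last `|h (k - 1)|` letters (one if `k = 0`) of `u k` followed
by `k` is both a prefix of it, where it comes from the occurrence of `u k` at `cut^[k] 2`, and a
suffix.

Such a long suffix of `u k` followed by `k` has a unique extension to the left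
(`exists_of_agree_suffix`), so `B` occurs in the factor at its two ends only, because `𝐰` has no
letter `0` strictly between the positions `2` and `cut 2`. The prefix of the factor that ends with
the occurrence of `u k` at `cut^[k] 3` is a suffix of `u (k + 2)` that already occurs as a suffix of
`u (k + 1)`; with one more letter it contains `u k` between the letters `k` and `k + 2`, which is
new. A longer proper prefix of the factor is not closed, since a border at least as long as `B`
would yield a third occurrence of `B`, while shorter borders occur at least three times
(`isNewClosed_and_shortest`).
-/

/-! ### Factors of an infinite word -/

section Factors

variable {α : Type*}

/-- The factor `w a, …, w (a + n - 1)` of length `n` of the infinite word `w`. -/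
def seg (w : ℕ → α) (a n : ℕ) : List α :=
  (List.range' a n).map w

@[simp]
theorem length_seg (w : ℕ → α) (a n : ℕ) : (seg w a n).length = n := by
  simp [seg]

@[simp]
theorem getElem_seg (w : ℕ → α) (a n i : ℕ) (hi : i < (seg w a n).length) :
    (seg w a n)[i] = w (a + i) := by
  simp [seg]

theorem seg_append (w : ℕ → α) (a n k : ℕ) : seg w a n ++ seg w (a + n) k = seg w a (n + k) := by
  simp [seg, ← List.map_append]

theorem seg_one (w : ℕ → α) (a : ℕ) : seg w a 1 = [w a] := by
  simp [seg]

theorem seg_succ (w : ℕ → α) (a n : ℕ) : seg w a (n + 1) = seg w a n ++ [w (a + n)] := by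
  rw [← seg_append, seg_one]

theorem drop_seg (w : ℕ → α) (a n i : ℕ) : (seg w a n).drop i = seg w (a + i) (n - i) :=
  List.ext_getElem (by simp) fun j _ _ => by simp [Nat.add_assoc]

theorem seg_congr {w : ℕ → α} {a b n : ℕ} (h : ∀ x < n, w (a + x) = w (b + x)) :
    seg w a n = seg w b n :=
  List.ext_getElem (by simp) fun j hj _ => by
    simpa using h j (by simpa using hj)

theorem occursAt_seg (w : ℕ → α) (a n : ℕ) : OccursAt (seg w a n) w a := by
  intro i hi
  simp

theorem OccursAt.eq_seg {x : List α} {w : ℕ → α} {a : ℕ} (h : OccursAt x w a) :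
    x = seg w a x.length :=
  List.ext_getElem (by simp) fun j hj _ => by simpa using h j hj

theorem seg_prefix_drop_seg (w : ℕ → α) (a b n l i : ℕ) :
    seg w b l <+: (seg w a n).drop i ↔ l ≤ n - i ∧ ∀ y < l, w (b + y) = w (a + i + y) := by
  rw [drop_seg]
  constructor
  · intro h
    have hl : l ≤ n - i := by simpa using h.length_le
    refine ⟨hl, fun y hy => ?_⟩
    have := h.getElem (i := y) (by simpa using hy)
    simpa using this
  · rintro ⟨hl, h⟩
    rw [seg_congr h, ← Nat.add_sub_cancel' hl, ← seg_append]
    exact List.prefix_append _ _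

variable [DecidableEq α]

theorem occurrences_seg (w : ℕ → α) (a b n l : ℕ) :
    occurrences (seg w b l) (seg w a n) = ((Finset.range (n + 1)).filter
      (fun i => l ≤ n - i ∧ ∀ y < l, w (b + y) = w (a + i + y))).card := by
  unfold occurrences
  rw [length_seg]
  congr 1
  ext i
  simp only [Finset.mem_filter, seg_prefix_drop_seg]

/-- A factor `w P, …, w (E - 1)` is the next member of the closed `z`-factorization if, for some
`P + ℓ ≤ T < E`, its prefix that ends before the position `T` is an old word, the prefix that ends
with `w T` is a new one, its prefix of length `ℓ` occurs in it exactly at its two ends, and the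
prefix of length `ℓ - 1` occurs once more just before the position `T`.

A shorter prefix `x` that is new has to contain `w T`; a border of `x` of length at least `ℓ` would
give an occurrence of the prefix of length `ℓ` in the interior of the factor, and a shorter border
occurs at least three times in `x`. -/
theorem isNewClosed_and_shortest {w : ℕ → α} {P T E ℓ : ℕ} (hℓ : 0 < ℓ) (hPT : P + ℓ ≤ T)
    (hTE : T < E)
    (hnew : ∀ q < P, ∃ x ≤ T - P, w (q + x) ≠ w (P + x))
    (hold : ∃ q < P, ∀ x < T - P, w (q + x) = w (P + x))
    (hborder : ∀ x < ℓ, w (P + x) = w (E - ℓ + x))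
    (htwice : ∀ j, P ≤ j → j + ℓ ≤ E → (∀ x < ℓ, w (j + x) = w (P + x)) → j = P ∨ j + ℓ = E)
    (hrep : ∀ x, x + 1 < ℓ → w (T + 1 - ℓ + x) = w (P + x)) :
    IsNewClosed (seg w 0 P) (seg w P (E - P)) ∧
      ∀ x, OccursAt x w P → IsNewClosed (seg w 0 P) x → E - P ≤ x.length := by
  have happ : ∀ n, seg w 0 P ++ seg w P n = seg w 0 (P + n) := fun n => by
    simpa using seg_append w 0 P n
  refine ⟨⟨Or.inr ⟨seg w P ℓ, ⟨?_, ?_, ?_⟩, ?_⟩, ?_⟩, ?_⟩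
  · intro h
    have := congrArg List.length h
    simp at this
    omega
  · have := (seg_prefix_drop_seg w P P (E - P) ℓ 0).2 ⟨by omega, by simp⟩
    simpa using this
  · have h1 : seg w P ℓ = (seg w P (E - P)).drop (E - P - ℓ) := by
      rw [drop_seg, show E - P - (E - P - ℓ) = ℓ by omega,
        show P + (E - P - ℓ) = E - ℓ by omega]
      exact seg_congr hborder
    rw [h1]
    exact List.drop_suffix _ _
  · rw [occurrences_seg, Finset.card_eq_two]
    refine ⟨0, E - ℓ - P, by omega, ?_⟩
    ext i
    simp only [Finset.mem_filter, Finset.mem_range, Finset.mem_insert, Finset.mem_singleton]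
    constructor
    · rintro ⟨-, h1, h2⟩
      have := htwice (P + i) (by omega) (by omega) fun x hx => (h2 x hx).symm
      omega
    · rintro (rfl | rfl)
      · exact ⟨by omega, by omega, fun y _ => rfl⟩
      · refine ⟨by omega, by omega, fun y hy => ?_⟩
        rw [hborder y hy, show P + (E - ℓ - P) = E - ℓ by omega]
  · rw [happ, occurrences_seg, Finset.card_eq_one]
    refine ⟨P, ?_⟩
    ext i
    simp only [Finset.mem_filter, Finset.mem_range, Finset.mem_singleton]
    constructor
    · rintro ⟨-, h1, h2⟩
      by_contra hne
      obtain ⟨x, hx, hx'⟩ := hnew i (by omega)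
      have h3 := h2 x (by omega)
      rw [Nat.zero_add] at h3
      exact hx' h3.symm
    · rintro rfl
      exact ⟨by omega, by omega, fun y _ => by rw [Nat.zero_add]⟩
  · intro x hx hxnew
    obtain ⟨hclosed, hocc⟩ := hxnew
    by_contra hlt
    have hxs := hx.eq_seg
    generalize x.length = L at hxs hlt
    subst hxs
    rw [happ, occurrences_seg, Finset.card_eq_one] at hocc
    obtain ⟨s, hs⟩ := hocc
    by_cases hLT : L ≤ T - P
    · obtain ⟨q, hq, hq'⟩ := hold
      have h1 : q ∈ ({s} : Finset ℕ) := by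
        rw [← hs]
        simp only [Finset.mem_filter, Finset.mem_range]
        exact ⟨by omega, by omega, fun y hy => by rw [Nat.zero_add, hq' y (by omega)]⟩
      have h2 : P ∈ ({s} : Finset ℕ) := by
        rw [← hs]
        simp only [Finset.mem_filter, Finset.mem_range]
        exact ⟨by omega, by omega, fun y hy => by rw [Nat.zero_add]⟩
      rw [Finset.mem_singleton] at h1 h2
      omega
    · rcases hclosed with h1 | ⟨b, ⟨hb0, hbp, hbs⟩, hb2⟩
      · simp at h1
        omega
      · have hbocc : OccursAt b w P := by
          intro i hi
          rw [hbp.getElem hi, getElem_seg]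
        have hbl := hbocc.eq_seg
        have hr0 : 0 < b.length := List.length_pos_iff.2 hb0
        have hrL : b.length ≤ L := by simpa using hbp.length_le
        have hsuf : ∀ y < b.length, w (P + y) = w (P + (L - b.length) + y) := by
          have h1 := List.suffix_iff_eq_drop.1 hbs
          rw [length_seg, drop_seg] at h1
          intro y hy
          have h2 := hbocc y hy
          rw [← h2]
          conv_lhs => rw [List.getElem_of_eq h1 hy]
          rw [getElem_seg]
        generalize b.length = r at *
        subst hbl
        rw [occurrences_seg] at hb2
        by_cases hr : ℓ ≤ r
        · have h1 := htwice (P + (L - r)) (by omega) (by omega)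
            fun x hx => (hsuf x (by omega)).symm
          have h2 : L = r := by omega
          have h3 : (Finset.range (L + 1)).filter
              (fun i => r ≤ L - i ∧ ∀ y < r, w (P + y) = w (P + i + y)) ⊆ {0} := by
            intro i hi
            simp only [Finset.mem_filter, Finset.mem_range] at hi
            rw [Finset.mem_singleton]
            omega
          have h4 := Finset.card_le_card h3
          rw [hb2, Finset.card_singleton] at h4
          omega
        · have h3 : ({0, T + 1 - ℓ - P, L - r} : Finset ℕ) ⊆ (Finset.range (L + 1)).filter
              (fun i => r ≤ L - i ∧ ∀ y < r, w (P + y) = w (P + i + y)) := by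
            intro i hi
            simp only [Finset.mem_insert, Finset.mem_singleton] at hi
            simp only [Finset.mem_filter, Finset.mem_range]
            rcases hi with rfl | rfl | rfl
            · exact ⟨by omega, by omega, fun y _ => rfl⟩
            · refine ⟨by omega, by omega, fun y hy => ?_⟩
              rw [show P + (T + 1 - ℓ - P) = T + 1 - ℓ by omega, hrep y (by omega)]
            · exact ⟨by omega, by omega, hsuf⟩
          have h4 := Finset.card_le_card h3
          rw [hb2, Finset.card_eq_three.2 ⟨0, T + 1 - ℓ - P, L - r, by omega, by omega, by omega,
            rfl⟩] at h4
          omega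

end Factors

/-! ### Desubstitution of the infinite word -/

section Desubstitution

variable (m : ℕ) [NeZero m]

local notation "𝐰" => infiniteMBonacci m

theorem letter_add (a b : ℕ) : letter m (a + b) = letter m a + letter m b := by
  apply Fin.ext
  simp [letter, Fin.ofNat, Fin.val_add]

@[simp]
theorem letter_zero : letter m 0 = 0 := rfl

@[simp]
theorem letter_self : letter m m = 0 := by
  apply Fin.ext
  simp [letter, Fin.ofNat]

theorem letter_val (a : Fin m) : letter m a.val = a := by
  apply Fin.ext
  simp [letter, Fin.ofNat, Nat.mod_eq_of_lt a.isLt]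

theorem letter_ne_zero {a : ℕ} (h0 : 0 < a) (h : a < m) : letter m a ≠ 0 := by
  intro h1
  have := congrArg Fin.val h1
  simp [letter, Fin.ofNat, Nat.mod_eq_of_lt h] at this
  omega

theorem add_letter_one_eq_zero_iff (a : Fin m) : a + letter m 1 = 0 ↔ ¬ a.val + 1 < m := by
  rw [← letter_val m a, ← letter_add, letter_val]
  constructor
  · intro h hlt
    exact letter_ne_zero m (Nat.succ_pos _) hlt h
  · intro h
    have : a.val + 1 = m := by have := a.isLt; omega
    rw [this, letter_self]

theorem length_mbonacciLetter (a : Fin m) :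
    (mbonacciLetter m a).length = if a + letter m 1 = 0 then 1 else 2 := by
  simp only [add_letter_one_eq_zero_iff, mbonacciLetter]
  split_ifs <;> simp_all

/-- The length of the image under the morphism of the prefix of length `i` of the infinite word.
The infinite word is the product of the images of its letters, and its `i`-th letter has its image
at the positions from `cut m i` to `cut m (i + 1) - 1`. The images under the `k`-th power of the
morphism start at the positions `(cut m)^[k] i`. -/
def cut : ℕ → ℕ
  | 0 => 0
  | i + 1 => cut i + (mbonacciLetter m (𝐰 i)).length

@[simp]
theorem cut_zero : cut m 0 = 0 := rfl

theorem cut_succ (i : ℕ) :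
    cut m (i + 1) = cut m i + if 𝐰 i + letter m 1 = 0 then 1 else 2 := by
  rw [cut, length_mbonacciLetter]

theorem cut_strictMono : StrictMono (cut m) :=
  strictMono_nat_of_lt_succ fun i => by
    rw [cut_succ]
    split_ifs <;> omega

theorem iterate_cut_strictMono (k : ℕ) : StrictMono (cut m)^[k] :=
  (cut_strictMono m).iterate k

@[simp]
theorem iterate_cut_zero (k : ℕ) : (cut m)^[k] 0 = 0 :=
  Function.iterate_fixed (cut_zero m) k

theorem mbonacciMorphism_append (u v : List (Fin m)) :
    mbonacciMorphism m (u ++ v) = mbonacciMorphism m u ++ mbonacciMorphism m v := by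
  simp [mbonacciMorphism]

variable {m}

theorem mbonacciMorphism_seg (hm : 2 ≤ m) (n : ℕ) : mbonacciMorphism m (seg 𝐰 0 n) = seg 𝐰 0 (cut m n) := by
  have hl : ∀ n, (mbonacciMorphism m (seg 𝐰 0 n)).length = cut m n := by
    intro n
    induction n with
    | zero => simp [mbonacciMorphism, seg]
    | succ n ih =>
      rw [seg_succ, mbonacciMorphism_append, List.length_append, ih, cut]
      simp [mbonacciMorphism]
  have h := (((eq_infiniteMBonacci_iff m hm 𝐰).1 rfl).2 _ (occursAt_seg 𝐰 0 n)).eq_seg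
  rwa [hl] at h

theorem mbonacciLetter_eq_seg (hm : 2 ≤ m) (i : ℕ) :
    mbonacciLetter m (𝐰 i) = seg 𝐰 (cut m i) (mbonacciLetter m (𝐰 i)).length := by
  have h := mbonacciMorphism_seg hm (i + 1)
  rw [seg_succ, mbonacciMorphism_append, mbonacciMorphism_seg hm, cut, ← seg_append] at h
  have h1 := List.append_cancel_left h
  simpa [mbonacciMorphism] using h1

theorem infiniteMBonacci_cut (hm : 2 ≤ m) (i : ℕ) : 𝐰 (cut m i) = 0 := by
  have h := mbonacciLetter_eq_seg hm i
  rw [length_mbonacciLetter] at h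
  have h0 : (mbonacciLetter m (𝐰 i))[0]? = some 0 := by
    unfold mbonacciLetter
    split_ifs <;> rfl
  rw [h] at h0
  split_ifs at h0 <;> simpa [seg, List.range'] using h0

/-- In `Fin m` this also holds if the image of `w i` is the single letter `0`: then the next
position starts the next image, and `w i + 1 = 0`. -/
theorem infiniteMBonacci_cut_add_one (hm : 2 ≤ m) (i : ℕ) : 𝐰 (cut m i + 1) = 𝐰 i + letter m 1 := by
  by_cases hi : 𝐰 i + letter m 1 = 0
  · have h := cut_succ m i
    rw [if_pos hi] at h
    rw [← h, infiniteMBonacci_cut hm, hi]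
  · have h := mbonacciLetter_eq_seg hm i
    rw [length_mbonacciLetter, if_neg hi] at h
    have hlt := mt (add_letter_one_eq_zero_iff m (𝐰 i)).2 hi
    rw [not_not] at hlt
    rw [mbonacciLetter, if_pos hlt, letter_add, letter_val] at h
    simp only [seg, List.range', List.map_cons, List.map_nil, List.cons.injEq] at h
    exact h.2.1.symm

theorem infiniteMBonacci_cut_succ_sub_one (hm : 2 ≤ m) (i : ℕ) :
    𝐰 (cut m (i + 1) - 1) = 𝐰 i + letter m 1 := by
  rw [cut_succ]
  split_ifs with h
  · rw [Nat.add_sub_cancel, infiniteMBonacci_cut hm, h]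
  · exact infiniteMBonacci_cut_add_one hm i

theorem eq_cut_or_eq_cut_add_one (j : ℕ) :
    ∃ i, j = cut m i ∨ (j = cut m i + 1 ∧ 𝐰 i + letter m 1 ≠ 0) := by
  induction j with
  | zero => exact ⟨0, Or.inl rfl⟩
  | succ j ih =>
    obtain ⟨i, rfl | ⟨rfl, hi⟩⟩ := ih
    · by_cases h : 𝐰 i + letter m 1 = 0
      · exact ⟨i + 1, Or.inl (by rw [cut_succ, if_pos h])⟩
      · exact ⟨i, Or.inr ⟨rfl, h⟩⟩
    · exact ⟨i + 1, Or.inl (by rw [cut_succ, if_neg hi])⟩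

theorem exists_eq_cut_of_eq_zero (hm : 2 ≤ m) {j : ℕ} (h : 𝐰 j = 0) : ∃ i, j = cut m i := by
  obtain ⟨i, hi | ⟨rfl, hi⟩⟩ := eq_cut_or_eq_cut_add_one (m := m) j
  · exact ⟨i, hi⟩
  · rw [infiniteMBonacci_cut_add_one hm] at h
    exact absurd h hi

theorem exists_eq_cut_add_one_of_ne_zero (hm : 2 ≤ m) {j : ℕ} (h : 𝐰 j ≠ 0) : ∃ i, j = cut m i + 1 := by
  obtain ⟨i, rfl | ⟨rfl, hi⟩⟩ := eq_cut_or_eq_cut_add_one (m := m) j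
  · exact absurd (infiniteMBonacci_cut hm i) h
  · exact ⟨i, rfl⟩

theorem infiniteMBonacci_zero (hm : 2 ≤ m) : 𝐰 0 = 0 := infiniteMBonacci_cut hm 0

theorem cut_one (hm : 2 ≤ m) : cut m 1 = 2 := by
  have h := cut_succ m 0
  rw [infiniteMBonacci_zero hm, zero_add (letter m 1), if_neg (letter_ne_zero m one_pos hm)] at h
  simpa using h

theorem infiniteMBonacci_one (hm : 2 ≤ m) : 𝐰 1 = letter m 1 := by
  have h := infiniteMBonacci_cut_add_one hm 0
  rwa [infiniteMBonacci_zero hm, zero_add, cut_zero, zero_add] at h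

theorem infiniteMBonacci_two (hm : 2 ≤ m) : 𝐰 2 = 0 := by
  have h := infiniteMBonacci_cut hm 1
  rwa [cut_one hm] at h

theorem infiniteMBonacci_three (hm : 2 ≤ m) : 𝐰 3 = letter m 2 := by
  have h := infiniteMBonacci_cut_add_one hm 1
  rwa [cut_one hm, infiniteMBonacci_one hm, ← letter_add] at h

theorem cut_two (hm : 2 ≤ m) : cut m 2 = if letter m 2 = 0 then 3 else 4 := by
  have h := cut_succ m 1
  rw [infiniteMBonacci_one hm, ← letter_add, cut_one hm] at h
  rw [h]
  split_ifs <;> rfl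

/-- Two prefixes of equal letters have images of equal length: `cut` is additive wherever a prefix
of the infinite word reappears. -/
theorem cut_add_of_agree {p n : ℕ} (h : ∀ x < n, 𝐰 (p + x) = 𝐰 x) :
    cut m (p + n) = cut m p + cut m n := by
  induction n with
  | zero => rfl
  | succ n ih =>
    rw [← Nat.add_assoc, cut_succ, cut_succ, ih fun x hx => h x (by omega), h n (by omega)]
    omega

/-! ### Palindromic prefixes and their occurrences -/

variable (m) in
/-- The length of the `k`-th palindromic prefix `u k` of the infinite word: `u 0` is empty, and
`u (k + 1)` is the image of `u k` under the morphism followed by the letter `0`. -/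
def palLength : ℕ → ℕ
  | 0 => 0
  | k + 1 => cut m (palLength k) + 1

variable (m) in
@[simp]
theorem palLength_zero : palLength m 0 = 0 := rfl

variable (m) in
theorem palLength_succ (k : ℕ) : palLength m (k + 1) = cut m (palLength m k) + 1 := rfl

theorem agree_iterate_cut (hm : 2 ≤ m) (k i : ℕ) :
    ∀ x < palLength m k, 𝐰 ((cut m)^[k] i + x) = 𝐰 x := by
  induction k with
  | zero => simp
  | succ k ih =>
    rw [Function.iterate_succ_apply', palLength_succ]
    generalize (cut m)^[k] i = p at ih
    intro y hy
    obtain ⟨x, rfl | ⟨rfl, -⟩⟩ := eq_cut_or_eq_cut_add_one (m := m) y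
    · have hx : x ≤ palLength m k := (cut_strictMono m).le_iff_le.1 (by omega)
      rw [← cut_add_of_agree fun y hy => ih y (by omega), infiniteMBonacci_cut hm,
        infiniteMBonacci_cut hm]
    · have hx : x < palLength m k := (cut_strictMono m).lt_iff_lt.1 (by omega)
      rw [← Nat.add_assoc, ← cut_add_of_agree fun y hy => ih y (by omega),
        infiniteMBonacci_cut_add_one hm, infiniteMBonacci_cut_add_one hm, ih x hx]

theorem cut_iterate_cut_add_palLength (hm : 2 ≤ m) (k i : ℕ) :
    cut m ((cut m)^[k] i + palLength m k) + 1 = (cut m)^[k + 1] i + palLength m (k + 1) := by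
  rw [cut_add_of_agree (agree_iterate_cut hm k i), Function.iterate_succ_apply', palLength_succ]
  omega

/-- The palindromic prefix `u k` occurs only where the image of a letter under the `k`-th power of
the morphism starts. -/
theorem exists_eq_iterate_cut (hm : 2 ≤ m) {k p : ℕ} (h : ∀ x < palLength m k, 𝐰 (p + x) = 𝐰 x) :
    ∃ i, p = (cut m)^[k] i := by
  induction k generalizing p with
  | zero => exact ⟨p, rfl⟩
  | succ k ih =>
    rw [palLength_succ] at h
    have h0 := h 0 (by omega)
    rw [Nat.add_zero, infiniteMBonacci_zero hm] at h0
    obtain ⟨q, rfl⟩ := exists_eq_cut_of_eq_zero hm h0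
    have hq : ∀ x < palLength m k, 𝐰 (q + x) = 𝐰 x := by
      intro x
      induction x using Nat.strong_induction_on with
      | _ x ihx =>
        intro hx
        have h1 := cut_strictMono m hx
        have h2 := h (cut m x + 1) (by omega)
        rw [← Nat.add_assoc, ← cut_add_of_agree fun y hy => ihx y hy (by omega),
          infiniteMBonacci_cut_add_one hm, infiniteMBonacci_cut_add_one hm] at h2
        exact add_right_cancel h2
    obtain ⟨i, rfl⟩ := ih hq
    exact ⟨i, (Function.iterate_succ_apply' _ _ _).symm⟩

theorem infiniteMBonacci_iterate_cut_add_palLength (hm : 2 ≤ m) (k i : ℕ) :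
    𝐰 ((cut m)^[k] i + palLength m k) = 𝐰 i + letter m k := by
  induction k with
  | zero => simp
  | succ k ih =>
    rw [← cut_iterate_cut_add_palLength hm, infiniteMBonacci_cut_add_one hm, ih, letter_add,
      add_assoc]

theorem infiniteMBonacci_iterate_cut_succ_sub_one (hm : 2 ≤ m) (k i : ℕ) :
    𝐰 ((cut m)^[k] (i + 1) - 1) = 𝐰 i + letter m k := by
  induction k with
  | zero => simp
  | succ k ih =>
    have h : 0 < (cut m)^[k] (i + 1) := by
      simpa using iterate_cut_strictMono m k (Nat.succ_pos i)
    obtain ⟨j, hj⟩ := Nat.exists_eq_succ_of_ne_zero h.ne'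
    rw [Function.iterate_succ_apply', hj, infiniteMBonacci_cut_succ_sub_one hm, letter_add,
      ← add_assoc, ← ih, hj]
    rfl

theorem infiniteMBonacci_palLength (hm : 2 ≤ m) (k : ℕ) : 𝐰 (palLength m k) = letter m k := by
  have h := infiniteMBonacci_iterate_cut_add_palLength hm k 0
  rwa [iterate_cut_zero, Nat.zero_add, infiniteMBonacci_zero hm, zero_add] at h

theorem infiniteMBonacci_palindrome (hm : 2 ≤ m) (k : ℕ) :
    ∀ x < palLength m k, 𝐰 (palLength m k - 1 - x) = 𝐰 x := by
  induction k with
  | zero => simp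
  | succ k ih =>
    have hcut : ∀ x ≤ palLength m k,
        cut m (palLength m k - x) + cut m x = cut m (palLength m k) := by
      intro x
      induction x with
      | zero => simp
      | succ x ihx =>
        intro hx
        have h1 := ihx (by omega)
        rw [show palLength m k - x = palLength m k - 1 - x + 1 by omega, cut_succ,
          ih x (by omega)] at h1
        rw [cut_succ, show palLength m k - (x + 1) = palLength m k - 1 - x by omega]
        omega
    intro y hy
    rw [palLength_succ] at hy ⊢
    obtain ⟨x, rfl | ⟨rfl, -⟩⟩ := eq_cut_or_eq_cut_add_one (m := m) y
    · have hx : x ≤ palLength m k := (cut_strictMono m).le_iff_le.1 (by omega)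
      have h1 := hcut x hx
      rw [show cut m (palLength m k) + 1 - 1 - cut m x = cut m (palLength m k - x) by omega,
        infiniteMBonacci_cut hm, infiniteMBonacci_cut hm]
    · have hx : x < palLength m k := (cut_strictMono m).lt_iff_lt.1 (by omega)
      have h1 := hcut x hx.le
      rw [show palLength m k - x = palLength m k - 1 - x + 1 by omega] at h1
      rw [show cut m (palLength m k) + 1 - 1 - (cut m x + 1) =
          cut m (palLength m k - 1 - x + 1) - 1 by omega,
        infiniteMBonacci_cut_succ_sub_one hm, infiniteMBonacci_cut_add_one hm, ih x hx]

/-! ### Lengths -/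

theorem palLength_succ_eq_add (hm : 2 ≤ m) (k : ℕ) :
    palLength m (k + 1) = palLength m k + (cut m)^[k] 1 := by
  induction k with
  | zero => simp [palLength_succ]
  | succ k ih =>
    rw [palLength_succ m (k + 1), Nat.add_comm (palLength m (k + 1)),
      ← cut_iterate_cut_add_palLength hm, ih, Nat.add_comm (palLength m k)]

theorem iterate_cut_pos (k : ℕ) : 0 < (cut m)^[k] 1 := by
  simpa using iterate_cut_strictMono m k one_pos

theorem iterate_cut_two (hm : 2 ≤ m) (k : ℕ) : (cut m)^[k] 2 = (cut m)^[k + 1] 1 := by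
  rw [Function.iterate_succ_apply, cut_one hm]

theorem palLength_mono (hm : 2 ≤ m) : Monotone (palLength m) :=
  monotone_nat_of_le_succ fun k => by
    rw [palLength_succ_eq_add hm]
    omega

theorem iterate_cut_le_palLength (hm : 2 ≤ m) (k : ℕ) : (cut m)^[k] 1 ≤ palLength m (k + 1) := by
  rw [palLength_succ_eq_add hm]
  omega

theorem iterate_cut_three (hm : 2 ≤ m) (k : ℕ) :
    (cut m)^[k] 3 = (cut m)^[k + 1] 1 + (cut m)^[k] 1 := by
  induction k with
  | zero => simp [cut_one hm]
  | succ k ih =>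
    rw [Function.iterate_succ_apply', ih, cut_add_of_agree fun x hx =>
      agree_iterate_cut hm (k + 1) 1 x (hx.trans_le (iterate_cut_le_palLength hm k)),
      ← Function.iterate_succ_apply' (cut m), ← Function.iterate_succ_apply' (cut m)]

theorem three_le_cut_two (hm : 2 ≤ m) : 3 ≤ cut m 2 := by
  rw [cut_two hm]
  split_ifs <;> omega

theorem iterate_cut_add_le (hm : 2 ≤ m) (k : ℕ) :
    (cut m)^[k + 1] 1 + (cut m)^[k] 1 ≤ (cut m)^[k + 2] 1 := by
  rw [← iterate_cut_three hm, Function.iterate_succ_apply, Function.iterate_succ_apply,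
    cut_one hm]
  exact (iterate_cut_strictMono m k).monotone (three_le_cut_two hm)

theorem palLength_add_two_le (hm : 2 ≤ m) (k : ℕ) : palLength m k + 2 ≤ (cut m)^[k + 1] 1 := by
  induction k with
  | zero => simp [cut_one hm]
  | succ k ih =>
    have h1 : (cut m)^[k + 1] 1 + (cut m)^[k] 1 ≤ (cut m)^[k + 1 + 1] 1 := iterate_cut_add_le hm k
    rw [palLength_succ_eq_add hm]
    omega

theorem iterate_cut_eq_palLength_add_one (hm : 2 ≤ m) {k : ℕ} (hk : k < m) :
    (cut m)^[k] 1 = palLength m k + 1 := by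
  induction k with
  | zero => simp
  | succ k ih =>
    rw [Function.iterate_succ_apply', ih (by omega), cut_succ, palLength_succ,
      infiniteMBonacci_palLength hm, ← letter_add,
      if_neg (letter_ne_zero m (Nat.succ_pos _) hk)]

theorem iterate_cut_add_palLength (hm : 2 ≤ m) {d : ℕ} :
    (cut m)^[d + m] 1 + palLength m d = palLength m (d + m) := by
  induction d with
  | zero =>
    obtain ⟨r, rfl⟩ : ∃ r, m = r + 1 := ⟨m - 1, by omega⟩
    rw [Nat.zero_add, palLength_zero, Nat.add_zero, Function.iterate_succ_apply',
      iterate_cut_eq_palLength_add_one hm (Nat.lt_succ_self r), cut_succ, palLength_succ,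
      infiniteMBonacci_palLength hm, ← letter_add, letter_self, if_pos rfl]
  | succ d ih =>
    rw [show d + 1 + m = d + m + 1 by omega, palLength_succ m (d + m), ← ih,
      cut_add_of_agree fun x hx => agree_iterate_cut hm (d + m) 1 x
        (hx.trans_le (palLength_mono hm (Nat.le_add_right _ _))),
      ← Function.iterate_succ_apply' (cut m), palLength_succ m d]
    exact (Nat.add_assoc _ _ _).symm

end Desubstitution

/-! ### Occurrences of long suffixes of palindromic prefixes -/

section Factorization

variable {m : ℕ} [NeZero m]

local notation "𝐰" => infiniteMBonacci m

theorem iterate_cut_iterate_cut_add_palLength (hm : 2 ≤ m) (d r i : ℕ) :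
    (cut m)^[d] ((cut m)^[r] i + palLength m r) + palLength m d =
      (cut m)^[d + r] i + palLength m (d + r) := by
  induction d with
  | zero => simp
  | succ d ih =>
    rw [← cut_iterate_cut_add_palLength hm, ih, cut_iterate_cut_add_palLength hm,
      show d + r + 1 = d + 1 + r by omega]

/-- Every letter `a` is the end of an occurrence of `u a` followed by `a`. -/
theorem exists_of_eq_letter (hm : 2 ≤ m) {a i : ℕ} (ha : a < m) (h : 𝐰 i = letter m a) :
    ∃ j, i = (cut m)^[a] j + palLength m a ∧ 𝐰 j = 0 := by
  induction a generalizing i with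
  | zero => exact ⟨i, rfl, h⟩
  | succ a ih =>
    obtain ⟨y, rfl⟩ := exists_eq_cut_add_one_of_ne_zero hm
      (h.trans_ne (letter_ne_zero m (Nat.succ_pos a) ha))
    rw [infiniteMBonacci_cut_add_one hm, letter_add] at h
    obtain ⟨j, rfl, hj⟩ := ih (by omega) (add_right_cancel h)
    exact ⟨j, cut_iterate_cut_add_palLength hm a j, hj⟩

/-- Every factor `00` is the end of an occurrence of `u m` followed by `0`. -/
theorem exists_of_double_zero (hm : 2 ≤ m) {j : ℕ} (h : 𝐰 j = 0) (h' : 𝐰 (j + 1) = 0) :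
    ∃ i, j + 1 = (cut m)^[m] i + palLength m m ∧ 𝐰 i = 0 := by
  obtain ⟨q, rfl⟩ := exists_eq_cut_of_eq_zero hm h
  rw [infiniteMBonacci_cut_add_one hm] at h'
  have hm1 : m - 1 + 1 = m := by omega
  have hq : 𝐰 q = letter m (m - 1) := by
    apply add_right_cancel (b := letter m 1)
    rw [h', ← letter_add, hm1, letter_self]
  obtain ⟨i, rfl, hi⟩ := exists_of_eq_letter hm (by omega) hq
  refine ⟨i, ?_, hi⟩
  rw [cut_iterate_cut_add_palLength hm, hm1]

variable (m) in
/-- The length of the border that witnesses that the `(k + 2)`-th factor is closed: the length of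
the `(k - 1)`-st finite `m`-bonacci word, and `1` for `k = 0`. -/
def borderLength : ℕ → ℕ
  | 0 => 1
  | k + 1 => (cut m)^[k] 1

theorem borderLength_pos (k : ℕ) : 0 < borderLength m k := by
  cases k with
  | zero => exact one_pos
  | succ k => exact iterate_cut_pos k

theorem borderLength_le (hm : 2 ≤ m) (k : ℕ) : borderLength m k ≤ palLength m k + 1 := by
  cases k with
  | zero => exact le_rfl
  | succ k => exact (iterate_cut_le_palLength hm k).trans (Nat.le_succ _)

theorem palLength_add_two_le_borderLength (hm : 2 ≤ m) (d : ℕ) :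
    palLength m d + 2 ≤ borderLength m (d + m) := by
  obtain ⟨r, hr⟩ : ∃ r, d + m = r + 2 := ⟨d + m - 2, by omega⟩
  rw [hr]
  have h1 := palLength_mono hm (show d ≤ r by omega)
  have h2 : palLength m r + 2 ≤ borderLength m (r + 2) := palLength_add_two_le hm r
  omega

theorem palLength_add_two_le_add (hm : 2 ≤ m) (k : ℕ) :
    palLength m k + 2 ≤ (cut m)^[k] 1 + borderLength m k := by
  cases k with
  | zero => simp [borderLength]
  | succ k =>
    have h1 := palLength_add_two_le hm k
    rw [palLength_succ_eq_add hm, borderLength]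
    omega

/-- The suffix of length `borderLength m k` of the word `u k` followed by the letter `k` occurs only
as a suffix of that word. If `k < m` the letter `k` alone forces the palindrome before it. If
`k ≥ m` the suffix is so long that it contains `u (k - m)` with the letter `k` on both sides, which
is obtained from the factor `00` by applying the morphism `k - m` times. -/
theorem exists_of_agree_suffix (hm : 2 ≤ m) {k i₀ j j₀ : ℕ} (hi₀ : 𝐰 i₀ = 0)
    (hj₀ : j₀ + borderLength m k = (cut m)^[k] i₀ + palLength m k + 1)
    (h : ∀ x < borderLength m k, 𝐰 (j + x) = 𝐰 (j₀ + x)) :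
    ∃ i, j + borderLength m k = (cut m)^[k] i + palLength m k + 1 ∧ 𝐰 i = 0 := by
  have hpos := borderLength_pos (m := m) k
  have hlast : 𝐰 (j + (borderLength m k - 1)) = letter m k := by
    rw [h _ (by omega), show j₀ + (borderLength m k - 1) = (cut m)^[k] i₀ + palLength m k by omega,
      infiniteMBonacci_iterate_cut_add_palLength hm, hi₀, zero_add]
  rcases lt_or_ge k m with hkm | hkm
  · obtain ⟨i, hi, hi'⟩ := exists_of_eq_letter hm hkm hlast
    exact ⟨i, by omega, hi'⟩
  · obtain ⟨d, rfl⟩ : ∃ d, k = d + m := ⟨k - m, by omega⟩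
    have hlen := palLength_add_two_le_borderLength hm d
    generalize borderLength m (d + m) = ℓ at *
    obtain ⟨r, hr⟩ : ∃ r, m = r + 1 := ⟨m - 1, by omega⟩
    obtain ⟨y, hy⟩ : ∃ y, (cut m)^[m] i₀ + palLength m m = cut m y + 1 := by
      refine ⟨(cut m)^[r] i₀ + palLength m r, ?_⟩
      rw [cut_iterate_cut_add_palLength hm, ← hr]
    rw [← iterate_cut_iterate_cut_add_palLength hm, hy] at hj₀
    have hq : ∀ x < palLength m d, 𝐰 (j + (ℓ - 1 - palLength m d) + x) = 𝐰 x := by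
      intro x hx
      rw [Nat.add_assoc, h _ (by omega),
        show j₀ + (ℓ - 1 - palLength m d + x) = (cut m)^[d] (cut m y + 1) + x by omega,
        agree_iterate_cut hm d _ x hx]
    obtain ⟨i₁, hi₁⟩ := exists_eq_iterate_cut hm hq
    have hzero : 𝐰 i₁ = 0 := by
      have h1 := infiniteMBonacci_iterate_cut_add_palLength hm d i₁
      rw [← hi₁, show j + (ℓ - 1 - palLength m d) + palLength m d = j + (ℓ - 1) by omega, hlast,
        letter_add, letter_self, add_zero] at h1
      exact left_eq_add.1 (h1.trans (add_comm _ _))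
    have hi₁0 : i₁ ≠ 0 := by
      rintro rfl
      rw [iterate_cut_zero] at hi₁
      omega
    obtain ⟨i₂, rfl⟩ := Nat.exists_eq_succ_of_ne_zero hi₁0
    have hzero' : 𝐰 i₂ = 0 := by
      have h1 := infiniteMBonacci_iterate_cut_succ_sub_one hm d i₂
      have h2 := infiniteMBonacci_iterate_cut_succ_sub_one hm d (cut m y)
      rw [infiniteMBonacci_cut hm, zero_add] at h2
      have h3 := h (ℓ - 2 - palLength m d) (by omega)
      rw [show j + (ℓ - 2 - palLength m d) = (cut m)^[d] (i₂ + 1) - 1 by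
          rw [← Nat.succ_eq_add_one, ← hi₁]; omega,
        show j₀ + (ℓ - 2 - palLength m d) = (cut m)^[d] (cut m y + 1) - 1 by omega, h1, h2] at h3
      exact add_eq_right.1 h3
    obtain ⟨i, hi, hi'⟩ := exists_of_double_zero hm hzero' hzero
    refine ⟨i, ?_, hi'⟩
    rw [← iterate_cut_iterate_cut_add_palLength hm, ← hi, ← Nat.succ_eq_add_one, ← hi₁]
    omega

/-! ### The factors are new, closed and shortest -/

variable (m) in
/-- The position in the infinite word at which the `(k + 2)`-th factor starts. -/
def factorStart (k : ℕ) : ℕ :=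
  (cut m)^[k + 1] 1 + palLength m k + 1 - borderLength m k

theorem factorStart_succ (hm : 2 ≤ m) (k : ℕ) :
    factorStart m (k + 1) = (cut m)^[k + 2] 1 + palLength m k + 1 := by
  have h := iterate_cut_pos (m := m) k
  change (cut m)^[k + 2] 1 + palLength m (k + 1) + 1 - (cut m)^[k] 1 = _
  rw [palLength_succ_eq_add hm]
  omega

theorem iterate_cut_cut_two (hm : 2 ≤ m) (k : ℕ) :
    (cut m)^[k] (cut m 2) = (cut m)^[k + 2] 1 := by
  rw [Function.iterate_succ_apply, Function.iterate_succ_apply, cut_one hm]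

theorem infiniteMBonacci_ne_zero_of_lt_cut_two (hm : 2 ≤ m) {i : ℕ} (h : 2 < i)
    (h' : i < cut m 2) : 𝐰 i ≠ 0 := by
  rw [cut_two hm] at h'
  split_ifs at h' with h2
  · omega
  · obtain rfl : i = 3 := by omega
    rwa [infiniteMBonacci_three hm]

/-- The position `T` of `isNewClosed_and_shortest` is `palLength m (k + 2)`. The letter there ends
the first occurrence of `u k` between the letters `k` and `k + 2`, because the infinite word starts
with `0102`, or with `0100` if `m = 2`. -/
theorem isNewClosed_and_shortest_infiniteMBonacci (hm : 2 ≤ m) (k : ℕ) :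
    IsNewClosed (seg 𝐰 0 (factorStart m k))
        (seg 𝐰 (factorStart m k) (factorStart m (k + 1) - factorStart m k)) ∧
      ∀ x, OccursAt x 𝐰 (factorStart m k) → IsNewClosed (seg 𝐰 0 (factorStart m k)) x →
        factorStart m (k + 1) - factorStart m k ≤ x.length := by
  have hℓ := borderLength_pos (m := m) k
  have hℓU := borderLength_le hm k
  have hlong := palLength_add_two_le_add hm k
  have hH := iterate_cut_pos (m := m) k
  have hE := factorStart_succ hm k
  have hP : factorStart m k + borderLength m k = (cut m)^[k + 1] 1 + palLength m k + 1 := by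
    rw [factorStart]
    omega
  have h3 := iterate_cut_three hm k
  have hT : palLength m (k + 2) = (cut m)^[k] 3 + palLength m k := by
    rw [palLength_succ_eq_add hm, palLength_succ_eq_add hm]
    omega
  have hle := iterate_cut_add_le hm k
  have hperiod : ∀ x < palLength m (k + 1), 𝐰 ((cut m)^[k + 1] 1 + x) = 𝐰 x :=
    agree_iterate_cut hm (k + 1) 1
  have hU1 := palLength_succ_eq_add hm k
  generalize hPdef : factorStart m k = P at *
  generalize hEdef : factorStart m (k + 1) = E at *
  generalize hTdef : palLength m (k + 2) = T at *
  refine isNewClosed_and_shortest (T := T) hℓ (by omega) (by omega) ?_ ?_ ?_ ?_ ?_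
  · -- An earlier occurrence of the new prefix would put `u k` at `cut^[k] i` with `i < 3`, where
    -- the letters `i - 1` and `i` of the infinite word agree with the letters `2` and `3`.
    intro q hq
    by_contra! hcon
    obtain ⟨r, hr⟩ : ∃ r, T = P + (r + 1) + palLength m k := ⟨T - P - palLength m k - 1, by omega⟩
    have hocc : ∀ x < palLength m k, 𝐰 (q + (r + 1) + x) = 𝐰 x := by
      intro x hx
      rw [Nat.add_assoc, hcon _ (by omega),
        show P + (r + 1 + x) = (cut m)^[k] 3 + x by omega, agree_iterate_cut hm k _ x hx]
    obtain ⟨i, hi⟩ := exists_eq_iterate_cut hm hocc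
    have hi3 : i < 3 := (iterate_cut_strictMono m k).lt_iff_lt.1 (by omega)
    have hi0 : i ≠ 0 := by
      rintro rfl
      rw [iterate_cut_zero] at hi
      omega
    have hnext : 𝐰 i = 𝐰 3 := by
      have h1 := hcon (r + 1 + palLength m k) (by omega)
      rw [← Nat.add_assoc, hi,
        show P + (r + 1 + palLength m k) = (cut m)^[k] 3 + palLength m k by omega,
        infiniteMBonacci_iterate_cut_add_palLength hm,
        infiniteMBonacci_iterate_cut_add_palLength hm] at h1
      exact add_right_cancel h1
    have hprev : 𝐰 (i - 1) = 𝐰 2 := by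
      have h1 := hcon r (by omega)
      have h2 : 𝐰 ((cut m)^[k] 3 - 1) = 𝐰 2 + letter m k :=
        infiniteMBonacci_iterate_cut_succ_sub_one hm k 2
      obtain ⟨i, rfl⟩ := Nat.exists_eq_succ_of_ne_zero hi0
      rw [show q + r = (cut m)^[k] (i + 1) - 1 by rw [← Nat.succ_eq_add_one, ← hi]; omega,
        show P + r = (cut m)^[k] 3 - 1 by omega, h2,
        infiniteMBonacci_iterate_cut_succ_sub_one hm] at h1
      exact add_right_cancel h1
    have hne : letter m 1 ≠ 0 := letter_ne_zero m one_pos hm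
    obtain rfl | rfl : i = 1 ∨ i = 2 := by omega
    · rw [infiniteMBonacci_one hm, infiniteMBonacci_three hm, letter_add m 1 1] at hnext
      exact hne (left_eq_add.1 hnext)
    · rw [infiniteMBonacci_two hm, show 2 - 1 = 1 from rfl, infiniteMBonacci_one hm] at hprev
      exact hne hprev
  · refine ⟨P - (cut m)^[k + 1] 1, ?_, fun x hx => ?_⟩
    · have := iterate_cut_pos (m := m) (k + 1)
      omega
    · rw [← hperiod _ (by omega)]
      congr 1
      omega
  · intro x hx
    -- Both ends are suffixes of `u k` followed by `k`, at the letters with numbers `2` and `cut 2`.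
    have hagree : ∀ i, 𝐰 i = 0 → ∀ y ≤ palLength m k,
        𝐰 ((cut m)^[k] i + y) = 𝐰 y := by
      intro i hi y hy
      rcases hy.lt_or_eq with hy | rfl
      · exact agree_iterate_cut hm k i y hy
      · rw [infiniteMBonacci_iterate_cut_add_palLength hm, hi, zero_add,
          infiniteMBonacci_palLength hm]
    have h1 := hagree 2 (infiniteMBonacci_two hm) (palLength m k + 1 - borderLength m k + x)
      (by omega)
    have h2 := hagree (cut m 2) (infiniteMBonacci_cut hm 2)
      (palLength m k + 1 - borderLength m k + x) (by omega)
    rw [iterate_cut_two hm] at h1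
    rw [iterate_cut_cut_two hm] at h2
    rw [show P + x = (cut m)^[k + 1] 1 + (palLength m k + 1 - borderLength m k + x) by omega,
      show E - borderLength m k + x =
        (cut m)^[k + 2] 1 + (palLength m k + 1 - borderLength m k + x) by omega, h1, h2]
  · intro j hj hj' hagree
    obtain ⟨i, hi, hi0⟩ := exists_of_agree_suffix hm (i₀ := 2) (j₀ := P) (infiniteMBonacci_two hm)
      (by rw [iterate_cut_two hm]; omega) hagree
    have h2i : 2 ≤ i := by
      rw [← (iterate_cut_strictMono m k).le_iff_le, iterate_cut_two hm]
      omega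
    have hi2 : i ≤ cut m 2 := by
      rw [← (iterate_cut_strictMono m k).le_iff_le, iterate_cut_cut_two hm]
      omega
    rcases h2i.eq_or_lt with rfl | h2i
    · left
      rw [iterate_cut_two hm] at hi
      omega
    · rcases hi2.eq_or_lt with rfl | hi2
      · right
        rw [iterate_cut_cut_two hm] at hi
        omega
      · exact absurd hi0 (infiniteMBonacci_ne_zero_of_lt_cut_two hm h2i hi2)
  · intro x hx
    rw [show P + x = (cut m)^[k + 1] 1 + (P + x - (cut m)^[k + 1] 1) by omega,
      hperiod _ (by omega),
      show T + 1 - borderLength m k + x =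
        (cut m)^[k + 1] 1 + ((cut m)^[k] 1 + (P + x - (cut m)^[k + 1] 1)) by omega,
      hperiod _ (by omega), agree_iterate_cut hm k 1 _ (by omega)]

/-! ### The factors as products of reversed finite words -/

theorem finiteMBonacci_eq_seg (hm : 2 ≤ m) (k : ℕ) :
    finiteMBonacci m k = seg 𝐰 0 ((cut m)^[k] 1) := by
  induction k with
  | zero => rw [Function.iterate_zero_apply, seg_one, infiniteMBonacci_zero hm]; rfl
  | succ k ih =>
    rw [finiteMBonacci_succ, ih, mbonacciMorphism_seg hm, Function.iterate_succ_apply']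

theorem revMBonacci_eq_seg (hm : 2 ≤ m) (k : ℕ) :
    revMBonacci m k = seg 𝐰 (palLength m k) ((cut m)^[k] 1) := by
  rw [revMBonacci, finiteMBonacci_eq_seg hm]
  refine List.ext_getElem (by simp) fun x hx _ => ?_
  simp only [List.length_reverse, length_seg] at hx
  have hU := palLength_succ_eq_add hm k
  have h := infiniteMBonacci_palindrome hm (k + 1) ((cut m)^[k] 1 - 1 - x) (by omega)
  rw [show palLength m (k + 1) - 1 - ((cut m)^[k] 1 - 1 - x) = palLength m k + x by omega] at h
  rw [List.getElem_reverse, getElem_seg, getElem_seg, h, length_seg, Nat.zero_add]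

theorem seg_append_of_eq {α : Type*} (w : ℕ → α) {a b n k : ℕ} (h : b = a + n) :
    seg w a n ++ seg w b k = seg w a (n + k) := by
  rw [h, seg_append]

theorem flatMap_revMBonacci (hm : 2 ≤ m) (a n : ℕ) :
    (List.range' a n).flatMap (revMBonacci m) =
      seg 𝐰 (palLength m a) (palLength m (a + n) - palLength m a) := by
  induction n with
  | zero => simp [seg]
  | succ n ih =>
    have h := palLength_mono hm (Nat.le_add_right a n)
    rw [List.range'_1_concat, List.flatMap_append, ih, List.flatMap_singleton,
      revMBonacci_eq_seg hm, seg_append_of_eq _ (by omega), ← Nat.add_assoc a n 1,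
      palLength_succ_eq_add hm (a + n)]
    congr 1
    omega

theorem seg_iterate_cut_add (hm : 2 ≤ m) {k i a n : ℕ} (h : a + n ≤ palLength m k) :
    seg 𝐰 ((cut m)^[k] i + a) n = seg 𝐰 a n :=
  seg_congr fun x hx => by
    rw [Nat.add_assoc, agree_iterate_cut hm k i _ (by omega)]

theorem closedFactor_two (hm : 2 ≤ m) :
    closedFactor m 2 = seg 𝐰 (factorStart m 0) (factorStart m 1 - factorStart m 0) := by
  have h1 : factorStart m 1 = cut m 2 + 1 := by
    rw [factorStart_succ hm, ← iterate_cut_cut_two hm]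
    rfl
  have h0 : factorStart m 0 = 2 := by
    simp [factorStart, borderLength, cut_one hm]
  have h4 : 𝐰 (cut m 2) = 0 := infiniteMBonacci_cut hm 2
  have h2 := infiniteMBonacci_two hm
  have h3 := infiniteMBonacci_three hm
  rw [h0, h1]
  rw [cut_two hm] at h4 ⊢
  by_cases hm2 : m = 2
  · subst hm2
    have hl : letter 2 2 = 0 := letter_self 2
    rw [if_pos hl] at h4 ⊢
    simp [closedFactor, seg, List.range', h2, h4]
  · have hl : letter m 2 ≠ 0 := letter_ne_zero m two_pos (by omega)
    rw [if_neg hl] at h4 ⊢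
    simp [closedFactor, hm2, seg, List.range', h2, h3, h4]

variable (m) in
theorem closedFactor_add_three (k : ℕ) :
    closedFactor m (k + 1 + 2) =
      if k + 3 < m then
        leftCancel [letter m k] (revMBonacci m k) ++ revMBonacci m (k + 1) ++ [letter m (k + 3)] ++
          (List.range (k + 1)).flatMap (revMBonacci m) ++ [letter m (k + 1)]
      else
        leftCancel [letter m k] (revMBonacci m k) ++ revMBonacci m (k + 1) ++
          (List.range' (k + 3 - m) (m - 2)).flatMap (revMBonacci m) ++ [letter m (k + 1)] := by
  rw [closedFactor]
  rfl

theorem closedFactor_eq_seg (hm : 2 ≤ m) (k : ℕ) :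
    closedFactor m (k + 2) =
      seg 𝐰 (factorStart m k) (factorStart m (k + 1) - factorStart m k) := by
  cases k with
  | zero => exact closedFactor_two hm
  | succ k =>
    have hH := iterate_cut_pos (m := m) k
    have hU1 := palLength_succ_eq_add hm k
    have hU2 : palLength m (k + 2) = palLength m (k + 1) + (cut m)^[k + 1] 1 :=
      palLength_succ_eq_add hm (k + 1)
    have hU3 : palLength m (k + 3) = palLength m (k + 2) + (cut m)^[k + 2] 1 :=
      palLength_succ_eq_add hm (k + 2)
    have hE2 : (cut m)^[k + 2] 1 + (cut m)^[k + 1] 1 ≤ (cut m)^[k + 3] 1 :=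
      iterate_cut_add_le hm (k + 1)
    have hlow := palLength_add_two_le hm k
    have hE3 := iterate_cut_cut_two hm (k + 1)
    have hfirst : leftCancel [letter m k] (revMBonacci m k) ++ revMBonacci m (k + 1) =
        seg 𝐰 (factorStart m (k + 1)) ((cut m)^[k] 1 - 1 + (cut m)^[k + 1] 1) := by
      rw [revMBonacci_eq_seg hm, revMBonacci_eq_seg hm, leftCancel, drop_seg,
        List.length_singleton, seg_append_of_eq _ (by omega), factorStart_succ hm, Nat.add_assoc,
        seg_iterate_cut_add hm (by omega)]
    have hlast : [letter m (k + 1)] = seg 𝐰 ((cut m)^[k + 3] 1 + palLength m (k + 1)) 1 := by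
      rw [seg_one, ← hE3, infiniteMBonacci_iterate_cut_add_palLength hm, infiniteMBonacci_cut hm,
        zero_add]
    have hshift : ∀ a, a ≤ palLength m (k + 1) →
        seg 𝐰 a (palLength m (k + 1) - a) =
          seg 𝐰 ((cut m)^[k + 3] 1 + a) (palLength m (k + 1) - a) := by
      intro a ha
      rw [← hE3, seg_iterate_cut_add hm (by omega)]
    have hS1 := factorStart_succ hm k
    have hS2 : factorStart m (k + 1 + 1) = (cut m)^[k + 3] 1 + palLength m (k + 1) + 1 :=
      factorStart_succ hm (k + 1)
    rw [closedFactor_add_three, hfirst, hlast]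
    split_ifs with hkm
    · have hn := iterate_cut_eq_palLength_add_one hm hkm
      have hmid : (List.range (k + 1)).flatMap (revMBonacci m) =
          seg 𝐰 ((cut m)^[k + 3] 1) (palLength m (k + 1)) := by
        rw [List.range_eq_range', flatMap_revMBonacci hm, Nat.zero_add]
        exact hshift 0 (Nat.zero_le _)
      have hletter : [letter m (k + 3)] = seg 𝐰 (palLength m (k + 3)) 1 := by
        rw [seg_one, infiniteMBonacci_palLength hm]
      rw [hmid, hletter, seg_append_of_eq _ (by omega), seg_append_of_eq _ (by omega),
        seg_append_of_eq _ (by omega)]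
      congr 1
      omega
    · obtain ⟨d, hd⟩ : ∃ d, k + 3 = d + m := ⟨k + 3 - m, by omega⟩
      have hn := iterate_cut_add_palLength hm (d := d)
      rw [← hd] at hn
      have hdk := palLength_mono hm (show d ≤ k + 1 by omega)
      have hmid : (List.range' (k + 3 - m) (m - 2)).flatMap (revMBonacci m) =
          seg 𝐰 ((cut m)^[k + 3] 1 + palLength m d) (palLength m (k + 1) - palLength m d) := by
        rw [show k + 3 - m = d by omega, flatMap_revMBonacci hm,
          show d + (m - 2) = k + 1 by omega]
        exact hshift _ hdk
      rw [hmid, seg_append_of_eq _ (by omega), seg_append_of_eq _ (by omega)]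
      congr 1
      omega

/-! ### The product of the factors -/

theorem productUpTo_succ {α : Type*} (z : ℕ → List α) (n : ℕ) :
    productUpTo z (n + 1) = productUpTo z n ++ z n := by
  simp [productUpTo, List.range_succ]

theorem productUpTo_closedFactor (hm : 2 ≤ m) (k : ℕ) :
    productUpTo (closedFactor m) (k + 2) = seg 𝐰 0 (factorStart m k) := by
  induction k with
  | zero =>
    simp [productUpTo, List.range_succ, closedFactor, factorStart, borderLength, cut_one hm, seg,
      List.range', infiniteMBonacci_zero hm, infiniteMBonacci_one hm]
  | succ k ih =>
    have hle : factorStart m k ≤ factorStart m (k + 1) := by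
      have h1 := factorStart_succ hm k
      have h2 := iterate_cut_add_le hm k
      rw [h1, factorStart]
      omega
    rw [show k + 1 + 2 = k + 2 + 1 by omega, productUpTo_succ, ih, closedFactor_eq_seg hm,
      seg_append_of_eq _ (by omega), Nat.add_sub_cancel' hle]

theorem isNewClosed_singleton {α : Type*} [DecidableEq α] {p : List α} {a : α} (h : a ∉ p) :
    IsNewClosed p [a] := by
  refine ⟨Or.inl rfl, ?_⟩
  rw [occurrences, Finset.card_eq_one]
  refine ⟨p.length, ?_⟩
  ext i
  simp only [Finset.mem_filter, Finset.mem_range, Finset.mem_singleton, List.length_append,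
    List.length_singleton]
  constructor
  · rintro ⟨hi, hpre⟩
    by_contra hne
    rcases lt_or_ge i p.length with hlt | hge
    · rw [List.drop_append_of_le_length hlt.le, List.drop_eq_getElem_cons hlt,
        List.cons_append, List.cons_prefix_cons] at hpre
      exact h (hpre.1 ▸ List.getElem_mem hlt)
    · rw [List.drop_of_length_le (by simp; omega)] at hpre
      exact List.cons_ne_nil _ _ (List.prefix_nil.1 hpre)
  · rintro rfl
    exact ⟨by omega, by simp⟩

theorem IsNewClosed.length_pos {α : Type*} [DecidableEq α] {p x : List α} (h : IsNewClosed p x) :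
    0 < x.length := by
  rcases h.1 with h1 | ⟨b, ⟨hb, hbx, -⟩, -⟩
  · omega
  · exact (List.length_pos_iff.2 hb).trans_le hbx.length_le

end Factorization

/-- For every `m ≥ 2`, the closed `z`-factorization of the infinite `m`-bonacci word is
`(z 0, z 1, z 2, …)`. -/
theorem mainTheorem1 (m : ℕ) [NeZero m] (hm : 2 ≤ m) :
    IsClosedZFactorization (infiniteMBonacci m) (closedFactor m) := by
  have h0 : productUpTo (closedFactor m) 0 = seg (infiniteMBonacci m) 0 0 := rfl
  have h1 : productUpTo (closedFactor m) 1 = seg (infiniteMBonacci m) 0 1 := by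
    simp [productUpTo, List.range_succ, closedFactor, seg_one, infiniteMBonacci_zero hm]
  refine ⟨fun n => ?_, fun n => ?_, fun n => ?_, fun n x hx hnew => ?_⟩ <;>
    rcases n with _ | _ | n
  · exact h0 ▸ occursAt_seg _ _ _
  · exact h1 ▸ occursAt_seg _ _ _
  · exact productUpTo_closedFactor hm n ▸ occursAt_seg _ _ _
  · rw [h0, length_seg, closedFactor, ← infiniteMBonacci_zero hm, ← seg_one]
    exact occursAt_seg _ _ _
  · rw [h1, length_seg, closedFactor, ← infiniteMBonacci_one hm, ← seg_one]
    exact occursAt_seg _ _ _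
  · rw [productUpTo_closedFactor hm, length_seg, closedFactor_eq_seg hm]
    exact occursAt_seg _ _ _
  · exact isNewClosed_singleton List.not_mem_nil
  · refine isNewClosed_singleton ?_
    rw [h1, seg_one, infiniteMBonacci_zero hm, List.mem_singleton]
    exact letter_ne_zero m one_pos hm
  · rw [productUpTo_closedFactor hm, closedFactor_eq_seg hm]
    exact (isNewClosed_and_shortest_infiniteMBonacci hm n).1
  · exact hnew.length_pos
  · exact hnew.length_pos
  · rw [productUpTo_closedFactor hm] at hx hnew
    rw [length_seg] at hx
    rw [closedFactor_eq_seg hm, length_seg]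
    exact (isNewClosed_and_shortest_infiniteMBonacci hm n).2 x hx hnew
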